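/- **Setting (vertex-weighted online matching with stochastic rewards).** An instance $I$ is a finite bipartite graph with offline vertices $U$ carrying weights $w_u>0$, and online vertices $V$ arriving in an arbitrary fixed order; $N_v\subseteq U$ and $N_u\subseteq V$ denote neighbourhoods. Let $p>0$ be the edge probability, and let $(\Theta_u)_{u\in U}$ be independent exponential random variables of mean one. For $f:[0,\infty)\to[0,1]$, *Stochastic Balance* starts with all loads $\ell_u$ and all dual variables $\alpha_u,\beta_v$ equal to $0$. When $v$ arrives, among the available $u\in N_v$ (those with $\ell_u<\Theta_u$) it picks one that maximizes $w_u\,p\,(1-f(\ell_u))$, ties being broken by a deterministic rule $\tau$ (which may depend on the instance, on $p$ and on the assignments made so far); it then updates $$\alpha_u\leftarrow\alpha_u+w_u\,p\,f(\ell_u),\qquad \beta_v\leftarrow w_u\,p\,(1-f(\ell_u)),\qquad \ell_u\leftarrow\ell_u+p ,$$ where $f(\ell_u)$ is evaluated at the load before the assignment. If no neighbour of $v$ is available, nothing happens. With $p_u(S)=\min(1,|S|p)$ and with final values of $\alpha,\beta$, set $$\mathcal L_\tau[f]:=\limsup_{p\to0^+}\ \inf_{I,\ u\in U,\ \emptyset\ne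 S\subseteq N_u}\ \frac{\mathbb E\big[\alpha_u+\sum_{v\in S}\beta_v\big]}{w_u\,p_u(S)} ,$$ and also set $$\mathcal L^{\mathrm{cf}}[f]:=\inf_{\ell\ge0,\ 0<\psi\le1,\ 0\le\tilde\psi\le\psi}\ \frac{\int_0^\ell e^{-z}f(z)\,dz+\int_\ell^{\ell+\tilde\psi}e^{-z}\,dz+(\psi-\tilde\psi)\big(1-f(\ell+\tilde\psi)\big)}{\psi}.$$ Let $\mathcal F_0$ be the class of all non-decreasing continuous $f:[0,\infty)\to[0,1]$ and $\mathcal F_1=\{f\in\mathcal F_0: f(1)\le1-1/e\}$. For $\mathcal F\subseteq\mathcal F_0$ put $\Gamma_\tau(\mathcal F)=\sup_{f\in\mathcal F}\mathcal L_\tau[f]$ and $\Gamma^{\mathrm{cf}}(\mathcal F)=\sup_{f\in\mathcal F}\mathcal L^{\mathrm{cf}}[f]$. **Proposition.** For every deterministic tie-breaking rule $\tau$, $$\Gamma_\tau(\mathcal F_0)\le0.5841\quad\text{and}\quad\Gamma_\tau(\mathcal F_1)\le0.5810 .$$ The same bounds hold for the closed form: $$\Gamma^{\mathrm{cf}}(\mathcal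 F_0)\le0.5841\quad\text{and}\quad\Gamma^{\mathrm{cf}}(\mathcal F_1)\le0.5810 .$$ -/

import Mathlib

open MeasureTheory ProbabilityTheory Filter Topology

namespace StochasticBalance

noncomputable section

/-- A vertex-weighted bipartite instance with `n` offline vertices, positive offline weights `w`, and
`m` online vertices which arrive in the order `0, 1, …, m - 1`; `nbr v` is the set of offline
neighbours of the online vertex `v`. -/
structure Instance (n m : ℕ) where
  w : Fin n → ℝ
  w_pos : ∀ u, 0 < w u
  nbr : Fin m → Finset (Fin n)

/-- The set `N_u` of online neighbours of the offline vertex `u`. -/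
def Instance.onlineNbr {n m : ℕ} (I : Instance n m) (u : Fin n) : Finset (Fin m) :=
  Finset.univ.filter fun v => u ∈ I.nbr v

/-- A deterministic tie-breaking rule. When the online vertex `v` arrives and the nonempty set `T`
consists of the available neighbours of `v` with the largest score, the rule picks an element of `T`.
The choice may depend on the instance, on the edge probability `p`, and on the assignments `a` made
so far (`a v' = none` when `v'` has not been assigned). -/
structure TieRule where
  pick : {n m : ℕ} → (I : Instance n m) → (p : ℝ) → (a : Fin m → Option (Fin n)) → (v : Fin m) →
    (T : Finset (Fin n)) → T.Nonempty → Fin n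
  pick_mem : ∀ {n m : ℕ} (I : Instance n m) p a v T hT, pick I p a v T hT ∈ T

instance : Nonempty TieRule :=
  ⟨⟨fun _ _ _ _ T hT => T.min' hT, fun _ _ _ _ T hT => T.min'_mem hT⟩⟩

/-- The state of a run: the assignments made so far, the loads of the offline vertices, and the dual
variables `α` and `β`. -/
structure State (n m : ℕ) where
  assigned : Fin m → Option (Fin n)
  load : Fin n → ℝ
  α : Fin n → ℝ
  β : Fin m → ℝ

/-- The state before the first arrival. -/
def State.init (n m : ℕ) : State n m where
  assigned := fun _ => none
  load := fun _ => 0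
  α := fun _ => 0
  β := fun _ => 0

/-- The neighbours of `v` that are available, i.e. whose load is below their threshold. -/
def available {n m : ℕ} (I : Instance n m) (Θ : Fin n → ℝ) (s : State n m) (v : Fin m) : Finset (Fin n) :=
  (I.nbr v).filter fun u => s.load u < Θ u

/-- The score `w_u · p · (1 - f(ℓ_u))` of an offline vertex. -/
def score {n m : ℕ} (I : Instance n m) (p : ℝ) (f : ℝ → ℝ) (s : State n m) (u : Fin n) : ℝ :=
  I.w u * p * (1 - f (s.load u))

/-- The available neighbours of `v` with the largest score (empty only if no neighbour is
available). -/
def candidates {n m : ℕ} (I : Instance n m) (p : ℝ) (f : ℝ → ℝ) (Θ : Fin n → ℝ) (s : State n m)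
    (v : Fin m) : Finset (Fin n) :=
  (available I Θ s v).filter fun u =>
    ∀ u' ∈ available I Θ s v, score I p f s u' ≤ score I p f s u

open Classical in
/-- One arrival in Stochastic Balance, together with the primal-dual update
`α_u ← α_u + w_u p f(ℓ_u)`, `β_v ← w_u p (1 - f(ℓ_u))`, where `ℓ_u` is the load of `u` at the time
of the assignment; the load of `u` then grows by `p`. If no neighbour of `v` is available, nothing
happens. -/
def step {n m : ℕ} (τ : TieRule) (I : Instance n m) (p : ℝ) (f : ℝ → ℝ) (Θ : Fin n → ℝ) (s : State n m)
    (v : Fin m) : State n m :=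
  if hT : (candidates I p f Θ s v).Nonempty then
    let u := τ.pick I p s.assigned v (candidates I p f Θ s v) hT
    { assigned := Function.update s.assigned v (some u)
      load := Function.update s.load u (s.load u + p)
      α := Function.update s.α u (s.α u + I.w u * p * f (s.load u))
      β := Function.update s.β v (I.w u * p * (1 - f (s.load u))) }
  else s

/-- The final state of Stochastic Balance on the instance `I` with thresholds `Θ`. -/
def run {n m : ℕ} (τ : TieRule) (I : Instance n m) (p : ℝ) (f : ℝ → ℝ) (Θ : Fin n → ℝ) : State n m :=
  (List.finRange m).foldl (step τ I p f Θ) (State.init n m)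

/-- The law of the thresholds: independent exponential random variables of mean one. -/
def thresholdLaw (n : ℕ) : Measure (Fin n → ℝ) :=
  Measure.pi fun _ => expMeasure 1

/-- The expected left-hand side `E[α_u + ∑_{v ∈ S} β_v]` of a constraint of the dual configuration
LP. -/
def expectedDual {n m : ℕ} (τ : TieRule) (I : Instance n m) (p : ℝ) (f : ℝ → ℝ) (u : Fin n)
    (S : Finset (Fin m)) : ℝ :=
  ∫ Θ, ((run τ I p f Θ).α u + ∑ v ∈ S, (run τ I p f Θ).β v) ∂(thresholdLaw n)

/-- The ratio `E[α_u + ∑_{v ∈ S} β_v] / (w_u · p_u(S))`, where `p_u(S) = min (1, |S| p)`. -/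
def ratio {n m : ℕ} (τ : TieRule) (I : Instance n m) (p : ℝ) (f : ℝ → ℝ) (u : Fin n)
    (S : Finset (Fin m)) : ℝ :=
  expectedDual τ I p f u S / (I.w u * min 1 ((S.card : ℝ) * p))

/-- The infimum of the ratio over all instances, all offline vertices `u` and all nonempty sets
`S ⊆ N_u`, for a fixed edge probability `p`. -/
def competitivenessAt (τ : TieRule) (f : ℝ → ℝ) (p : ℝ) : EReal :=
  ⨅ (n : ℕ) (m : ℕ) (I : Instance n m) (u : Fin n) (S : Finset (Fin m)) (_ : S.Nonempty)
    (_ : S ⊆ I.onlineNbr u), ((ratio τ I p f u S : ℝ) : EReal)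

/-- The competitiveness `L[f]` of Stochastic Balance in the regime of vanishing edge probabilities,
with the limit `p → 0⁺` read as an upper limit. -/
def competitiveness (τ : TieRule) (f : ℝ → ℝ) : EReal :=
  limsup (competitivenessAt τ f) (𝓝[>] (0 : ℝ))

/-- The limiting value (divided by the weight) of `E[α_u + ∑_{v ∈ S} β_v]` when the adversary uses a
pre-load `l`, then loads with `u` as only neighbour of total mass `ψ'`, then loads of total mass
`ψ - ψ'` that go to another vertex whose score equals that of `u`. -/
def kappa (f : ℝ → ℝ) (l ψ ψ' : ℝ) : ℝ :=
  (∫ z in (0 : ℝ)..l, Real.exp (-z) * f z) + (∫ z in l..(l + ψ'), Real.exp (-z))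
    + (ψ - ψ') * (1 - f (l + ψ'))

/-- The closed form of `L[f]`: the infimum of `κ(ℓ, ψ, ψ') / ψ` over `ℓ ≥ 0`, `0 < ψ ≤ 1` and
`0 ≤ ψ' ≤ ψ`. -/
def closedForm (f : ℝ → ℝ) : EReal :=
  ⨅ (l : ℝ) (ψ : ℝ) (ψ' : ℝ) (_ : 0 ≤ l) (_ : 0 < ψ ∧ ψ ≤ 1) (_ : 0 ≤ ψ' ∧ ψ' ≤ ψ),
    ((kappa f l ψ ψ' / ψ : ℝ) : EReal)

/-- The non-decreasing continuous functions `[0, ∞) → [0, 1]` (values at negative arguments are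
irrelevant). -/
def F₀ : Set (ℝ → ℝ) :=
  {f | ContinuousOn f (Set.Ici 0) ∧ MonotoneOn f (Set.Ici 0) ∧
    Set.MapsTo f (Set.Ici 0) (Set.Icc 0 1)}

/-- The functions in `F₀` with `f 1 ≤ 1 - 1/e`. -/
def F₁ : Set (ℝ → ℝ) :=
  F₀ ∩ {f | f 1 ≤ 1 - 1 / Real.exp 1}

/-- The optimal value of the program `max_{f ∈ F} L[f]`. -/
def optValue (L : (ℝ → ℝ) → EReal) (F : Set (ℝ → ℝ)) : EReal :=
  ⨆ f ∈ F, L f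

end

end StochasticBalance

/-! All four bounds follow from one: on the whole of `F₀` both the closed form and the limiting
ratio are at most 0.581.

For the closed form (`exists_kappa_le`) only ψ = 1 is needed. Write F(l) = ∫₀ˡ e^{-z} f(z) dz and
suppose that κ(l, 1, y) > 0.581 for all l ≥ 0 and y ∈ [0, 1]. With y = x - l < 1 this bounds f(x)
from above in terms of F(l). Integrating such bounds gives upper bounds on F at larger arguments,
which feed the next bounds on f. The bootstrap runs through 0.1, 0.2, 0.4, 0.65. At y = 1 the value
f(l + y) drops out of κ, and F(0.65) + e^{-0.65} - e^{-1.65} turns out to be below 0.581, a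
contradiction.

For the algorithm (`competitiveness_le_closedForm`), an explicit adversary realizes each κ(l, ψ,
ψ')/ψ in the limit: `privateInstance` sends loads l and ψ' to the vertex 0 alone, then arrivals of
mass ψ - ψ' to private vertices whose score barely beats that of 0. The winner is always strict, so
the tie rule plays no role. This needs f(0) < 1; if f(0) = 1, two vertices competing for one arrival
already give ratio 0. -/

namespace StochasticBalance

/-! ### The closed form -/

lemma integral_exp_neg (a b : ℝ) :
    ∫ z in a..b, Real.exp (-z) = Real.exp (-a) - Real.exp (-b) := by
  rw [intervalIntegral.integral_eq_sub_of_hasDerivAt (f := fun z => -Real.exp (-z))]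
  · ring
  · intro x _
    exact ((hasDerivAt_neg x).exp.neg).congr_deriv (by ring)
  · exact (by fun_prop : Continuous fun z : ℝ => Real.exp (-z)).intervalIntegrable _ _

lemma integral_exp_neg_mul_affine (C B a b : ℝ) :
    ∫ z in a..b, Real.exp (-z) * (C + B * z)
      = Real.exp (-a) * (C + B * a + B) - Real.exp (-b) * (C + B * b + B) := by
  rw [intervalIntegral.integral_eq_sub_of_hasDerivAt
    (f := fun z => -(Real.exp (-z) * (C + B * z + B)))]
  · ring
  · intro x _
    have h1 : HasDerivAt (fun z : ℝ => Real.exp (-z)) (-Real.exp (-x)) x := by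
      simpa using (hasDerivAt_neg x).exp
    have h2 : HasDerivAt (fun z : ℝ => C + B * z + B) B x := by
      simpa using (((hasDerivAt_id x).const_mul B).const_add C).add_const B
    refine (h1.mul h2).neg.congr_deriv ?_
    ring
  · exact (by fun_prop : Continuous fun z : ℝ => Real.exp (-z) * (C + B * z)).intervalIntegrable _ _

lemma intervalIntegrable_exp_neg_mul {f : ℝ → ℝ} (hf : ContinuousOn f (Set.Ici 0)) {a b : ℝ}
    (ha : 0 ≤ a) (hb : 0 ≤ b) :
    IntervalIntegrable (fun z => Real.exp (-z) * f z) volume a b := by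
  refine ContinuousOn.intervalIntegrable ?_
  refine ContinuousOn.mul (by fun_prop) (hf.mono ?_)
  intro x hx
  exact (le_min ha hb).trans hx.1

lemma integral_le_of_le_affine {f : ℝ → ℝ} (hf : ContinuousOn f (Set.Ici 0)) {a b : ℝ}
    (ha : 0 ≤ a) (hab : a ≤ b) (C B : ℝ) (h : ∀ x ∈ Set.Icc a b, f x ≤ C + B * x) :
    ∫ z in (0 : ℝ)..b, Real.exp (-z) * f z ≤ (∫ z in (0 : ℝ)..a, Real.exp (-z) * f z) +
      (Real.exp (-a) * (C + B * a + B) - Real.exp (-b) * (C + B * b + B)) := by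
  rw [← intervalIntegral.integral_add_adjacent_intervals
    (intervalIntegrable_exp_neg_mul hf le_rfl ha)
    (intervalIntegrable_exp_neg_mul hf ha (ha.trans hab)), ← integral_exp_neg_mul_affine]
  gcongr
  refine intervalIntegral.integral_mono_on hab
    (intervalIntegrable_exp_neg_mul hf ha (ha.trans hab)) ?_ fun x hx => ?_
  · exact (by fun_prop : Continuous fun z : ℝ => Real.exp (-z) * (C + B * z)).intervalIntegrable _ _
  · exact mul_le_mul_of_nonneg_left (h x hx) (Real.exp_pos _).le

/-- The quartic Taylor term t⁴/24 absorbs the remainder, which is at most |t|⁵/100. -/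
lemma cubic_le_exp_neg {t : ℝ} (ht : |t| ≤ 1) : 1 - t + t ^ 2 / 2 - t ^ 3 / 6 ≤ Real.exp (-t) := by
  have h := Real.exp_bound (x := -t) (by rwa [abs_neg]) (n := 5) (by norm_num)
  rw [abs_neg] at h
  have h1 := (abs_le.1 h).1
  norm_num [Finset.sum_range_succ, Nat.factorial] at h1
  have h2 : |t| ^ 4 = t ^ 4 := by rw [← abs_pow, abs_of_nonneg (by positivity)]
  have h3 : |t| ^ 5 ≤ t ^ 4 := by
    rw [pow_succ, h2]; exact mul_le_of_le_one_right (by positivity) ht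
  have h4 : 0 ≤ t ^ 4 := by positivity
  nlinarith

lemma abs_exp_neg_sub_taylor_le {x : ℝ} (hx : |x| ≤ 1) :
    |Real.exp (-x) - (1 - x + x ^ 2 / 2 - x ^ 3 / 6 + x ^ 4 / 24 - x ^ 5 / 120 + x ^ 6 / 720
      - x ^ 7 / 5040)| ≤ |x| ^ 8 / 35840 := by
  have h := Real.exp_bound (x := -x) (by rwa [abs_neg]) (n := 8) (by norm_num)
  rw [abs_neg] at h
  norm_num [Finset.sum_range_succ, Nat.factorial] at h
  convert h using 2
  · ring
  · ring

/-- If the constraint `G ≤ κ(l, 1, x - l)` holds, then `f x` lies below an explicit affine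
function. -/
lemma le_affine_of_le_kappa {f : ℝ → ℝ} {G F E l m c Q B x : ℝ}
    (h : G ≤ F + (Real.exp (-l) - Real.exp (-x)) + (1 - (x - l)) * (1 - f x))
    (hE : Real.exp (-l) ≤ E) (hc0 : 0 ≤ c) (hc : c ≤ Real.exp (-m)) (hxm : |x - m| ≤ 1)
    (hxl : 0 < 1 - (x - l))
    (hp : (1 - (x - l)) * (1 - Q - B * (x - m)) ≤ G - F - E +
      c * (1 - (x - m) + (x - m) ^ 2 / 2 - (x - m) ^ 3 / 6)) :
    f x ≤ (Q - B * m) + B * x := by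
  have h1 : Real.exp (-x) = Real.exp (-m) * Real.exp (-(x - m)) := by
    rw [← Real.exp_add]; ring_nf
  -- Expanding e^{-x} around m makes `hp` a polynomial inequality in x - m with rational
  -- coefficients.
  have h2 : c * (1 - (x - m) + (x - m) ^ 2 / 2 - (x - m) ^ 3 / 6) ≤ Real.exp (-x) := by
    rw [h1]
    calc _ ≤ c * Real.exp (-(x - m)) := mul_le_mul_of_nonneg_left (cubic_le_exp_neg hxm) hc0
      _ ≤ _ := mul_le_mul_of_nonneg_right hc (Real.exp_pos _).le
  have h3 : (1 - (x - l)) * (1 - Q - B * (x - m)) ≤ (1 - (x - l)) * (1 - f x) := by linarith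
  have := le_of_mul_le_mul_left h3 hxl
  linarith

lemma kappa_one (f : ℝ → ℝ) (l x : ℝ) :
    kappa f l 1 (x - l) = (∫ z in (0 : ℝ)..l, Real.exp (-z) * f z)
      + (Real.exp (-l) - Real.exp (-x)) + (1 - (x - l)) * (1 - f x) := by
  rw [kappa, integral_exp_neg, add_sub_cancel]

lemma exists_kappa_le {f : ℝ → ℝ} (hf : f ∈ F₀) :
    ∃ l y : ℝ, 0 ≤ l ∧ 0 ≤ y ∧ y ≤ 1 ∧ kappa f l 1 y ≤ 0.581 := by
  by_contra! H
  have hc := hf.1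
  have K : ∀ l x : ℝ, 0 ≤ l → l ≤ x → x ≤ l + 1 →
      0.581 ≤ (∫ z in (0 : ℝ)..l, Real.exp (-z) * f z)
        + (Real.exp (-l) - Real.exp (-x)) + (1 - (x - l)) * (1 - f x) := by
    intro l x h0 h1 h2
    rw [← kappa_one]
    exact (H l (x - l) h0 (by linarith) (by linarith)).le
  have e10 := abs_le.1 (abs_exp_neg_sub_taylor_le (x := 0.1) (by norm_num [abs_le]))
  have e20 := abs_le.1 (abs_exp_neg_sub_taylor_le (x := 0.2) (by norm_num [abs_le]))
  have e40 := abs_le.1 (abs_exp_neg_sub_taylor_le (x := 0.4) (by norm_num [abs_le]))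
  have e65 := abs_le.1 (abs_exp_neg_sub_taylor_le (x := 0.65) (by norm_num [abs_le]))
  have e05 := abs_le.1 (abs_exp_neg_sub_taylor_le (x := 0.05) (by norm_num [abs_le]))
  have e15 := abs_le.1 (abs_exp_neg_sub_taylor_le (x := 0.15) (by norm_num [abs_le]))
  have e30 := abs_le.1 (abs_exp_neg_sub_taylor_le (x := 0.3) (by norm_num [abs_le]))
  have e52 := abs_le.1 (abs_exp_neg_sub_taylor_le (x := 0.52) (by norm_num [abs_le]))
  have e1 := abs_le.1 (abs_exp_neg_sub_taylor_le (x := 1) (by norm_num [abs_le]))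
  rw [abs_of_nonneg (by norm_num)] at e10 e20 e40 e65 e05 e15 e30 e52 e1
  norm_num at e10 e20 e40 e65 e05 e15 e30 e52 e1
  -- In `p0` to `p3` the affine function is, up to rounding, the tangent at m (0.05, 0.15, 0.3,
  -- 0.52) to the upper bound on f that the constraint with pre-load l yields; the value at m is
  -- rounded up. `E` and `c` are rational bounds for e^{-l} and e^{-m}.
  have p0 : ∀ x ∈ Set.Icc (0 : ℝ) 0.1, f x ≤ (0.4399 - 0.4116 * 0.05) + 0.4116 * x := by
    rintro x ⟨h0, h1⟩
    refine le_affine_of_le_kappa (l := 0) (c := 0.95122) (K 0 x le_rfl h0 (by linarith))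
      (E := 1) (by simp) (by norm_num) (by norm_num; linarith) (by rw [abs_le]; constructor <;> linarith)
      (by linarith) ?_
    rw [intervalIntegral.integral_same]
    obtain ⟨t, rfl⟩ : ∃ t, x = t + 0.05 := ⟨x - 0.05, by ring⟩
    nlinarith [mul_nonneg (sq_nonneg t) (by linarith : 0 ≤ 0.06 - t)]
  have i1 := integral_le_of_le_affine hc le_rfl (by norm_num) _ _ p0
  rw [intervalIntegral.integral_same] at i1
  norm_num at i1
  replace i1 : ∫ z in (0 : ℝ)..(1 / 10), Real.exp (-z) * f z ≤ 0.04184 := by linarith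
  have p1 : ∀ x ∈ Set.Icc (0.1 : ℝ) 0.2, f x ≤ (0.479 - 0.3575 * 0.15) + 0.3575 * x := by
    rintro x ⟨h0, h1⟩
    refine le_affine_of_le_kappa (l := 1 / 10) (c := 0.8607)
      (K (1 / 10) x (by norm_num) (by linarith) (by linarith))
      (E := 0.90484) (by norm_num; linarith) (by norm_num) (by norm_num; linarith)
      (by rw [abs_le]; constructor <;> linarith) (by linarith) ?_
    obtain ⟨t, rfl⟩ : ∃ t, x = t + 0.15 := ⟨x - 0.15, by ring⟩
    nlinarith [mul_nonneg (sq_nonneg t) (by linarith : 0 ≤ 0.06 - t)]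
  have i2 := integral_le_of_le_affine hc (by norm_num) (by norm_num) _ _ p1
  norm_num at i2
  replace i2 : ∫ z in (0 : ℝ)..(1 / 5), Real.exp (-z) * f z ≤ 0.08307 := by linarith
  -- The pre-load need not be the left endpoint: here l = 0.1, and l = 0.2 in `p3`, with the bounds
  -- on F(l) already obtained.
  have p2 : ∀ x ∈ Set.Icc (0.2 : ℝ) 0.4, f x ≤ (0.5312 - 0.3399 * 0.3) + 0.3399 * x := by
    rintro x ⟨h0, h1⟩
    refine le_affine_of_le_kappa (l := 1 / 10) (c := 0.74081)
      (K (1 / 10) x (by norm_num) (by linarith) (by linarith))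
      (E := 0.90484) (by norm_num; linarith) (by norm_num) (by norm_num; linarith)
      (by rw [abs_le]; constructor <;> linarith) (by linarith) ?_
    obtain ⟨t, rfl⟩ : ∃ t, x = t + 0.3 := ⟨x - 0.3, by ring⟩
    nlinarith [mul_nonneg (sq_nonneg t) (by linarith : 0 ≤ 0.11 - t)]
  have i3 := integral_le_of_le_affine hc (by norm_num) (by norm_num) _ _ p2
  norm_num at i3
  replace i3 : ∫ z in (0 : ℝ)..(2 / 5), Real.exp (-z) * f z ≤ 0.16175 := by linarith
  have p3 : ∀ x ∈ Set.Icc (0.4 : ℝ) 0.65, f x ≤ (0.5976 - 0.2823 * 0.52) + 0.2823 * x := by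
    rintro x ⟨h0, h1⟩
    refine le_affine_of_le_kappa (l := 1 / 5) (c := 0.59451)
      (K (1 / 5) x (by norm_num) (by linarith) (by linarith))
      (E := 0.81874) (by norm_num; linarith) (by norm_num) (by norm_num; linarith)
      (by rw [abs_le]; constructor <;> linarith) (by linarith) ?_
    obtain ⟨t, rfl⟩ : ∃ t, x = t + 0.52 := ⟨x - 0.52, by ring⟩
    nlinarith [mul_nonneg (sq_nonneg t) (by linarith : 0 ≤ 0.1301 - t)]
  have i4 := integral_le_of_le_affine hc (by norm_num) (by norm_num) _ _ p3
  norm_num at i4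
  -- Taking y = 1 removes f(l + y). The factor e^{-1.65} is split as e^{-0.65} · e^{-1} because the
  -- Taylor estimate covers only |x| ≤ 1.
  have k := K (13 / 20) (13 / 20 + 1) (by norm_num) (by norm_num) (by norm_num)
  rw [add_sub_cancel_left, sub_self, zero_mul, neg_add, Real.exp_add] at k
  have hprod : (0.52204 : ℝ) * 0.3678 ≤ Real.exp (-(13 / 20)) * Real.exp (-1) := by
    gcongr <;> linarith
  norm_num at hprod
  linarith

theorem closedForm_le {f : ℝ → ℝ} (hf : f ∈ F₀) : closedForm f ≤ ((0.581 : ℝ) : EReal) := by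
  obtain ⟨l, y, hl, hy, hy1, h⟩ := exists_kappa_le hf
  refine (iInf_le_of_le l <| iInf_le_of_le 1 <| iInf_le_of_le y <| iInf_le_of_le hl <|
    iInf_le_of_le ⟨one_pos, le_rfl⟩ <| iInf_le_of_le ⟨hy, hy1⟩ ?_)
  rw [div_one]
  exact_mod_cast h

/-! ### Stochastic Balance on a preloaded vertex -/

section Step

variable {n m : ℕ} (τ : TieRule) (I : Instance n m) (p : ℝ) (f : ℝ → ℝ) (Θ : Fin n → ℝ)
  (s : State n m) (v : Fin m)

lemma step_of_candidates_eq_empty (h : candidates I p f Θ s v = ∅) : step τ I p f Θ s v = s := by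
  rw [step, dif_neg (by simp [h])]

open Classical in
lemma step_of_candidates_eq_singleton {u : Fin n} (h : candidates I p f Θ s v = {u}) :
    step τ I p f Θ s v =
      { assigned := Function.update s.assigned v (some u)
        load := Function.update s.load u (s.load u + p)
        α := Function.update s.α u (s.α u + I.w u * p * f (s.load u))
        β := Function.update s.β v (I.w u * p * (1 - f (s.load u))) } := by
  have hT : (candidates I p f Θ s v).Nonempty := by simp [h]
  have hu : τ.pick I p s.assigned v (candidates I p f Θ s v) hT = u := by
    have := τ.pick_mem I p s.assigned v (candidates I p f Θ s v) hT
    exact Finset.mem_singleton.1 ((congrArg (_ ∈ ·) h).mp this)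
  rw [step, dif_pos hT]
  simp only [hu]

/-- An invariant that holds initially and is preserved by every arrival holds at the end. -/
lemma run_induction (P : ℕ → State n m → Prop) (h0 : P 0 (State.init n m))
    (hs : ∀ k (hk : k < m) s, P k s → P (k + 1) (step τ I p f Θ s ⟨k, hk⟩)) :
    P m (run τ I p f Θ) := by
  have key : ∀ k ≤ m,
      P k (((List.finRange m).take k).foldl (step τ I p f Θ) (State.init n m)) := by
    intro k
    induction k with
    | zero => intro _; simpa using h0
    | succ k ih =>
      intro hk
      rw [List.take_succ_eq_append_getElem (by simpa using hk), List.foldl_append]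
      simpa using hs k hk _ (ih (by omega))
  have := key m le_rfl
  rwa [List.take_of_length_le (by simp)] at this

end Step

/-- The instance in which the first `M` of `m` online vertices are adjacent only to the offline
vertex `0`, of weight one, and every later one is also adjacent to its own private offline vertex, of
weight `W`. -/
def privateInstance (M m : ℕ) (W : ℝ) (hW : 0 < W) : Instance (m + 1) m where
  w := Fin.cons 1 fun _ => W
  w_pos := Fin.cases one_pos fun _ => hW
  nbr v := if v.val < M then {0} else {0, v.succ}

/-- The description of the state of a run on `privateInstance M m W` after `k` arrivals, when the
vertex `0` has threshold `θ`. -/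
structure PrivateState (p : ℝ) (f : ℝ → ℝ) (M : ℕ) (W θ : ℝ) {m : ℕ} (k : ℕ)
    (s : State (m + 1) m) : Prop where
  load_alive : (min k M : ℕ) * p < θ → s.load 0 = (min k M : ℕ) * p
  -- Once dead, the load is frozen at its first value ≥ θ; unavailability needs only the inequality.
  load_dead : θ ≤ (min k M : ℕ) * p → θ ≤ s.load 0
  α_zero : s.α 0 = ∑ j ∈ Finset.range (min k M), if j * p < θ then p * f (j * p) else 0
  β_eq : ∀ v : Fin m, s.β v = if v.val < k then
      if v.val < M then if v.val * p < θ then p * (1 - f (v.val * p)) else 0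
      else W * p * (1 - f 0) else 0
  load_succ : ∀ v : Fin m, k ≤ v.val → s.load v.succ = 0

lemma PrivateState.step_of_lt {τ : TieRule} {p : ℝ} {f : ℝ → ℝ} {M m : ℕ} {W : ℝ} (hW : 0 < W)
    {Θ : Fin (m + 1) → ℝ} (hp : 0 < p) {k : ℕ} (hk : k < m) (hkM : k < M)
    {s : State (m + 1) m} (h : PrivateState p f M W (Θ 0) k s) :
    PrivateState p f M W (Θ 0) (k + 1)
      (step τ (privateInstance M m W hW) p f Θ s ⟨k, hk⟩) := by
  obtain ⟨h1, h2, h3, h4, h5⟩ := h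
  have m1 : min k M = k := by omega
  have m2 : min (k + 1) M = k + 1 := by omega
  rw [m1] at h1 h2 h3
  have hlt : (k : ℝ) * p < (k + 1 : ℕ) * p := by push_cast; nlinarith
  by_cases ha : (k : ℝ) * p < Θ 0
  · have hl := h1 ha
    rw [step_of_candidates_eq_singleton (u := 0)]
    swap
    · ext u
      simp only [candidates, available, privateInstance, hkM, if_true, Finset.mem_filter,
        Finset.mem_singleton]
      constructor
      · exact fun h => h.1.1
      · rintro rfl
        refine ⟨⟨rfl, by rwa [hl]⟩, ?_⟩
        rintro u ⟨rfl, _⟩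
        exact le_rfl
    constructor <;> dsimp only
    · intro _
      rw [m2, Function.update_self, hl]; push_cast; ring
    · intro h
      rw [m2] at h
      rw [Function.update_self, hl]; push_cast at h; linarith
    · rw [m2, Finset.sum_range_succ, ← h3, if_pos ha, Function.update_self, hl]
      simp [privateInstance]
    · intro v
      by_cases hv : v = ⟨k, hk⟩
      · subst hv
        simp [hkM, ha, hl, privateInstance]
      · rw [Function.update_of_ne hv, h4]
        have : v.val ≠ k := fun h => hv (Fin.ext h)
        have : v.val < k ↔ v.val < k + 1 := by omega
        simp only [this]
    · intro v hv
      rw [Function.update_of_ne (Fin.succ_ne_zero v), h5 v (by omega)]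
  · have hl := h2 (not_lt.1 ha)
    rw [step_of_candidates_eq_empty]
    swap
    · ext u
      simp only [candidates, available, privateInstance, hkM, if_true, Finset.mem_filter,
        Finset.mem_singleton, Finset.notMem_empty, iff_false]
      rintro ⟨⟨rfl, h⟩, _⟩
      exact absurd h hl.not_gt
    constructor
    · intro h
      rw [m2] at h
      exact absurd (hlt.trans h) ha
    · exact fun _ => hl
    · rw [m2, Finset.sum_range_succ, ← h3, if_neg ha, add_zero]
    · intro v
      rw [h4]
      by_cases hv : v.val = k
      · simp [hv, ha, hkM]
      · have : v.val < k ↔ v.val < k + 1 := by omega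
        simp only [this]
    · exact fun v hv => h5 v (by omega)

/-- The private vertex is fresh and, by `hWf`, has a strictly larger score than 0 whenever 0 is
available. It therefore wins whether or not 0 is alive, and the resulting β does not depend on the
thresholds. -/
lemma PrivateState.step_of_le {τ : TieRule} {p : ℝ} {f : ℝ → ℝ} {M m : ℕ} {W : ℝ} (hW : 0 < W)
    (hWf : 1 - f (M * p) < W * (1 - f 0))
    {Θ : Fin (m + 1) → ℝ} (hp : 0 < p) (hΘ : ∀ u, 0 < Θ u) {k : ℕ} (hk : k < m) (hkM : M ≤ k)
    {s : State (m + 1) m} (h : PrivateState p f M W (Θ 0) k s) :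
    PrivateState p f M W (Θ 0) (k + 1)
      (step τ (privateInstance M m W hW) p f Θ s ⟨k, hk⟩) := by
  obtain ⟨h1, h2, h3, h4, h5⟩ := h
  have m1 : min k M = M := by omega
  have m2 : min (k + 1) M = M := by omega
  rw [m1] at h1 h2 h3
  have hl : s.load (Fin.succ ⟨k, hk⟩) = 0 := h5 ⟨k, hk⟩ le_rfl
  have hne : (0 : Fin (m + 1)) ≠ Fin.succ ⟨k, hk⟩ := (Fin.succ_ne_zero _).symm
  have hscore : s.load 0 < Θ 0 → score (privateInstance M m W hW) p f s 0
      < score (privateInstance M m W hW) p f s (Fin.succ ⟨k, hk⟩) := by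
    intro h0
    have hM : s.load 0 = M * p := h1 (by by_contra! hcon; exact (h2 hcon).not_gt h0)
    simp only [score, hM, hl, privateInstance, Fin.cons_zero, Fin.cons_succ]
    nlinarith
  rw [step_of_candidates_eq_singleton (u := Fin.succ ⟨k, hk⟩)]
  swap
  · ext u
    simp only [candidates, available, Finset.mem_filter, Finset.mem_singleton]
    have hn : (privateInstance M m W hW).nbr ⟨k, hk⟩ = {0, Fin.succ ⟨k, hk⟩} := by
      simp [privateInstance, hkM]
    simp only [hn, Finset.mem_insert, Finset.mem_singleton]
    constructor
    · rintro ⟨⟨rfl | rfl, h0⟩, hmax⟩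
      · exact absurd (hscore h0) (hmax _ ⟨Or.inr rfl, by rw [hl]; exact hΘ _⟩).not_gt
      · rfl
    · rintro rfl
      refine ⟨⟨Or.inr rfl, by rw [hl]; exact hΘ _⟩, ?_⟩
      rintro u ⟨rfl | rfl, h0⟩
      · exact (hscore h0).le
      · exact le_rfl
  constructor <;> dsimp only
  · intro h
    rw [m2] at h ⊢
    rw [Function.update_of_ne hne, h1 h]
  · intro h
    rw [m2] at h
    rw [Function.update_of_ne hne]
    exact h2 h
  · rw [m2, Function.update_of_ne hne, h3]
  · intro v
    by_cases hv : v = ⟨k, hk⟩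
    · subst hv
      have hw : (privateInstance M m W hW).w (Fin.succ ⟨k, hk⟩) = W := rfl
      rw [Function.update_self, hl, hw]
      simp [hkM.not_gt]
    · rw [Function.update_of_ne hv, h4]
      have : v.val ≠ k := fun h => hv (Fin.ext h)
      have : v.val < k ↔ v.val < k + 1 := by omega
      simp only [this]
  · intro v hv
    rw [Function.update_of_ne, h5 v (by omega)]
    intro h
    have := congrArg Fin.val h
    simp at this
    omega

lemma privateState_run (τ : TieRule) {p : ℝ} {f : ℝ → ℝ} {M m : ℕ} {W : ℝ} (hW : 0 < W)
    (hWf : 1 - f (M * p) < W * (1 - f 0)) {Θ : Fin (m + 1) → ℝ} (hp : 0 < p)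
    (hΘ : ∀ u, 0 < Θ u) :
    PrivateState p f M W (Θ 0) m (run τ (privateInstance M m W hW) p f Θ) := by
  refine run_induction τ _ p f Θ (fun k s => PrivateState p f M W (Θ 0) k s) ?_ ?_
  · constructor <;> simp [State.init]
  · intro k hk s h
    rcases lt_or_ge k M with hkM | hkM
    · exact h.step_of_lt hW hp hk hkM
    · exact h.step_of_le hW hWf hp hΘ hk hkM

/-! ### Thresholds and expectations -/

instance isProbabilityMeasure_expMeasure_one : IsProbabilityMeasure (expMeasure 1) :=
  isProbabilityMeasure_expMeasure one_pos

instance isProbabilityMeasure_thresholdLaw (n : ℕ) : IsProbabilityMeasure (thresholdLaw n) :=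
  inferInstanceAs (IsProbabilityMeasure (Measure.pi fun _ => expMeasure 1))

lemma expMeasure_one_real_Ioi {x : ℝ} (hx : 0 ≤ x) :
    (expMeasure 1).real (Set.Ioi x) = Real.exp (-x) := by
  rw [← Set.compl_Iic, probReal_compl_eq_one_sub measurableSet_Iic, ← cdf_eq_real,
    cdf_expMeasure_eq one_pos, if_pos hx, one_mul]
  ring

lemma ae_thresholdLaw_pos (n : ℕ) : ∀ᵐ Θ ∂(thresholdLaw n), ∀ u, 0 < Θ u := by
  rw [ae_all_iff]
  intro u
  have h : ∀ᵐ x ∂(expMeasure 1), 0 < x := by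
    have h0 : (expMeasure 1).real (Set.Iic 0) = 0 := by
      rw [← cdf_eq_real, cdf_expMeasure_eq one_pos]
      simp
    rw [ae_iff]
    simpa [Set.Iic_def, measureReal_eq_zero_iff] using h0
  exact (measurePreserving_eval (fun _ => expMeasure 1) u).quasiMeasurePreserving.ae h

lemma thresholdLaw_real_lt {n : ℕ} (u : Fin n) {x : ℝ} (hx : 0 ≤ x) :
    (thresholdLaw n).real {Θ | x < Θ u} = Real.exp (-x) := by
  rw [← expMeasure_one_real_Ioi hx]
  exact (measurePreserving_eval (fun _ : Fin n => expMeasure 1) u).measureReal_preimage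
    measurableSet_Ioi.nullMeasurableSet

lemma measurableSet_lt_eval {n : ℕ} (u : Fin n) (x : ℝ) :
    MeasurableSet {Θ : Fin n → ℝ | x < Θ u} :=
  measurableSet_lt measurable_const (measurable_pi_apply u)

lemma integrable_ite_lt {n : ℕ} (u : Fin n) (x c : ℝ) :
    Integrable (fun Θ : Fin n → ℝ => if x < Θ u then c else 0) (thresholdLaw n) :=
  (integrable_const c).indicator (measurableSet_lt_eval u x)

lemma integral_ite_lt {n : ℕ} (u : Fin n) {x : ℝ} (hx : 0 ≤ x) (c : ℝ) :
    ∫ Θ, (if x < Θ u then c else 0) ∂(thresholdLaw n) = Real.exp (-x) * c := by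
  have h := integral_indicator_const (μ := thresholdLaw n) c (measurableSet_lt_eval u x)
  rw [thresholdLaw_real_lt u hx, smul_eq_mul] at h
  exact h

/-! ### Expected dual value of the adversarial instance -/

/-- The online vertices from position `a` on. -/
def tail (a m : ℕ) : Finset (Fin m) := Finset.univ.filter fun v => a ≤ v.val

lemma sum_tail (a m : ℕ) (g : ℕ → ℝ) : ∑ v ∈ tail a m, g v.val = ∑ j ∈ Finset.Ico a m, g j := by
  rw [tail, Finset.sum_filter, Fin.sum_univ_eq_sum_range (fun j => if a ≤ j then g j else 0) m,
    ← Finset.sum_filter]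
  congr 1
  ext j
  simp [and_comm]

lemma card_tail (a m : ℕ) : (tail a m).card = m - a := by
  have h := sum_tail a m fun _ => 1
  simp only [Finset.sum_const, Nat.card_Ico, nsmul_eq_mul, mul_one] at h
  exact_mod_cast h

lemma expectedDual_privateInstance (τ : TieRule) {p : ℝ} {f : ℝ → ℝ} {a M m : ℕ} {W : ℝ}
    (hW : 0 < W) (hWf : 1 - f (M * p) < W * (1 - f 0)) (hp : 0 < p) (haM : a ≤ M) (hM : M ≤ m) :
    expectedDual τ (privateInstance M m W hW) p f 0 (tail a m)
      = ∑ j ∈ Finset.range a, Real.exp (-(j * p)) * (p * f (j * p))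
        + ∑ j ∈ Finset.Ico a M, Real.exp (-(j * p)) * p + (m - M : ℕ) * (W * p * (1 - f 0)) := by
  have hae : (fun Θ => (run τ (privateInstance M m W hW) p f Θ).α 0
        + ∑ v ∈ tail a m, (run τ (privateInstance M m W hW) p f Θ).β v)
      =ᵐ[thresholdLaw (m + 1)] fun Θ =>
        ((∑ j ∈ Finset.range a, if j * p < Θ 0 then p * f (j * p) else 0)
        + ∑ j ∈ Finset.Ico a M, if j * p < Θ 0 then p else 0) + (m - M : ℕ) * (W * p * (1 - f 0)) := by
    filter_upwards [ae_thresholdLaw_pos (m + 1)] with Θ hΘ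
    have h := privateState_run τ (m := m) hW hWf hp hΘ
    rw [h.α_zero, min_eq_right hM, Finset.sum_congr rfl fun v _ => h.β_eq v]
    simp only [Fin.is_lt, if_true]
    -- On positions in [a, M) the α-increment p f and the β-value p (1 - f) belong to the same
    -- arrival and add up to p.
    rw [sum_tail a m fun j => if j < M then if j * p < Θ 0 then p * (1 - f (j * p)) else 0
      else W * p * (1 - f 0), ← Finset.sum_Ico_consecutive _ haM hM,
      ← Finset.sum_range_add_sum_Ico _ haM, add_assoc, add_assoc, ← add_assoc (∑ j ∈ Finset.Ico a M, _),
      ← Finset.sum_add_distrib]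
    congr 2
    · refine Finset.sum_congr rfl fun j hj => ?_
      rw [if_pos (Finset.mem_Ico.1 hj).2]
      split_ifs <;> ring
    · rw [Finset.sum_congr rfl fun j hj => if_neg (Finset.mem_Ico.1 hj).1.not_gt]
      simp
  have i1 : ∀ (s : Finset ℕ) (c : ℕ → ℝ), Integrable (fun Θ : Fin (m + 1) → ℝ =>
      ∑ j ∈ s, if j * p < Θ 0 then c j else 0) (thresholdLaw (m + 1)) :=
    fun s c => integrable_finsetSum _ fun j _ => integrable_ite_lt 0 _ _
  have i2 : ∀ (s : Finset ℕ) (c : ℕ → ℝ), ∫ Θ : Fin (m + 1) → ℝ,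
      (∑ j ∈ s, if j * p < Θ 0 then c j else 0) ∂(thresholdLaw (m + 1))
        = ∑ j ∈ s, Real.exp (-(j * p)) * c j := by
    intro s c
    rw [integral_finsetSum _ fun j _ => integrable_ite_lt 0 _ _]
    exact Finset.sum_congr rfl fun j _ => integral_ite_lt 0 (by positivity) _
  rw [expectedDual, integral_congr_ae hae, integral_add (by exact (i1 _ _).add (i1 _ _)) (integrable_const _),
    integral_add (i1 _ _) (i1 _ _), i2, i2]
  simp

/-- A left Riemann sum of `e^{-z} h(z)` with `h` non-decreasing and non-negative is at most `e^p`
times the integral. -/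
lemma sum_exp_neg_mul_le {h : ℝ → ℝ} (hc : ContinuousOn h (Set.Ici 0)) (hm : MonotoneOn h (Set.Ici 0))
    (h0 : ∀ x, 0 ≤ x → 0 ≤ h x) {p : ℝ} (hp : 0 < p) {a b : ℕ} (hab : a ≤ b) :
    ∑ j ∈ Finset.Ico a b, Real.exp (-(j * p)) * (p * h (j * p))
      ≤ Real.exp p * ∫ z in (a * p)..(b * p), Real.exp (-z) * h z := by
  have hint : ∀ i j : ℕ, IntervalIntegrable (fun z => Real.exp (-z) * h z) volume (i * p) (j * p) :=
    fun i j => intervalIntegrable_exp_neg_mul hc (by positivity) (by positivity)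
  have hs := intervalIntegral.sum_integral_adjacent_intervals_Ico (a := fun k : ℕ => (k : ℝ) * p)
    hab fun k _ => hint k (k + 1)
  rw [← hs, Finset.mul_sum]
  refine Finset.sum_le_sum fun j _ => ?_
  have hj : (0 : ℝ) ≤ j * p := by positivity
  have hjj : (j : ℝ) * p ≤ (j + 1 : ℕ) * p := by push_cast; nlinarith
  -- On one cell h is at least its left value and e^{-z} at least its right value; the latter costs
  -- the factor e^p.
  have hle : ∫ _ in (j * p)..((j + 1 : ℕ) * p), Real.exp (-((j + 1 : ℕ) * p)) * h (j * p)
      ≤ ∫ z in (j * p)..((j + 1 : ℕ) * p), Real.exp (-z) * h z := by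
    refine intervalIntegral.integral_mono_on hjj (by simp) (hint _ _) fun z hz => ?_
    exact mul_le_mul (Real.exp_le_exp.2 (by linarith [hz.2])) (hm hj (hj.trans hz.1) hz.1)
      (h0 _ hj) (Real.exp_pos _).le
  rw [intervalIntegral.integral_const, smul_eq_mul] at hle
  refine le_trans (le_of_eq ?_) (mul_le_mul_of_nonneg_left hle (Real.exp_pos p).le)
  have : Real.exp (-(j * p)) = Real.exp p * Real.exp (-((j + 1 : ℕ) * p)) := by
    rw [← Real.exp_add]; push_cast; ring_nf
  rw [this]; push_cast; ring

lemma F₀.intervalIntegrable {f : ℝ → ℝ} (hf : f ∈ F₀) {a b : ℝ} (ha : 0 ≤ a) (hb : 0 ≤ b) :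
    IntervalIntegrable (fun z => Real.exp (-z) * f z) volume a b :=
  intervalIntegrable_exp_neg_mul hf.1 ha hb

/-- The adversarial instance with `a` preloads, then `b` vertices adjacent only to `0`, then vertices
with a private alternative up to a total of `N` vertices in `S`. -/
lemma competitivenessAt_le (τ : TieRule) {f : ℝ → ℝ} (hf : f ∈ F₀) (hf0 : f 0 < 1) {p : ℝ}
    (hp : 0 < p) {a b N : ℕ} (hb : b ≤ N) (hN : 0 < N) (hNp : N * p ≤ 1) :
    competitivenessAt τ f p ≤ (((Real.exp p * ((∫ z in (0 : ℝ)..(a * p), Real.exp (-z) * f z)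
      + (Real.exp (-(a * p)) - Real.exp (-(a * p + b * p))))
      + (N * p - b * p) * (1 - f (a * p + b * p) + p)) / (N * p) : ℝ) : EReal) := by
  have hMp : (0 : ℝ) ≤ (a + b : ℕ) * p := by positivity
  have hM1 : f ((a + b : ℕ) * p) ≤ 1 := (hf.2.2 hMp).2
  -- This weight gives a fresh private vertex the score of 0 at load (a + b)p, up to an excess `p`
  -- (before the common factor `p`) that breaks the tie and vanishes in the limit.
  have hW : 0 < (1 - f ((a + b : ℕ) * p) + p) / (1 - f 0) := div_pos (by linarith) (by linarith)
  have hWf : (1 - f ((a + b : ℕ) * p) + p) / (1 - f 0) * (1 - f 0)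
      = 1 - f ((a + b : ℕ) * p) + p := div_mul_cancel₀ _ (by linarith)
  have hE := expectedDual_privateInstance τ (f := f) (a := a) (M := a + b) (m := a + N) hW
    (by rw [hWf]; linarith) hp (by omega) (by omega)
  have hcard : (tail a (a + N)).card = N := by rw [card_tail]; omega
  refine iInf_le_of_le _ <| iInf_le_of_le _ <|
    iInf_le_of_le (privateInstance (a + b) (a + N) _ hW) <| iInf_le_of_le 0 <|
    iInf_le_of_le (tail a (a + N)) <| iInf_le_of_le (Finset.card_pos.1 (by omega)) <|
    iInf_le_of_le ?_ ?_
  · intro v _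
    refine Finset.mem_filter.2 ⟨Finset.mem_univ _, ?_⟩
    dsimp only [privateInstance]
    split_ifs <;> simp
  · rw [EReal.coe_le_coe_iff, ratio, hE, hcard]
    have hw : (privateInstance (a + b) (a + N) _ hW).w 0 = 1 := rfl
    rw [hw, one_mul, min_eq_right hNp]
    have hNp0 : 0 < N * p := by positivity
    gcongr ?_ / _
    have s1 := sum_exp_neg_mul_le hf.1 hf.2.1 (fun x hx => (hf.2.2 hx).1) hp (Nat.zero_le a)
    have s2 := sum_exp_neg_mul_le (h := fun _ => 1) continuousOn_const monotoneOn_const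
      (fun _ _ => zero_le_one) hp (Nat.le_add_right a b)
    simp only [mul_one] at s2
    rw [integral_exp_neg] at s2
    rw [Nat.Ico_zero_eq_range, Nat.cast_zero, zero_mul] at s1
    have hc : ((a + N - (a + b) : ℕ) : ℝ) = N - b := by
      rw [Nat.add_sub_add_left, Nat.cast_sub hb]
    have hab : ((a + b : ℕ) : ℝ) * p = a * p + b * p := by push_cast; ring
    rw [mul_right_comm _ p, hWf, hc]
    rw [hab] at s2 ⊢
    linarith

/-! ### Passage to vanishing edge probabilities -/

lemma tendsto_natFloor_div_mul {c : ℝ} (hc : 0 ≤ c) :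
    Tendsto (fun p : ℝ => (⌊c / p⌋₊ : ℝ) * p) (𝓝[>] 0) (𝓝 c) := by
  refine ((tendsto_nat_floor_mul_div_atTop hc).comp tendsto_inv_nhdsGT_zero).congr fun p => ?_
  simp [div_eq_mul_inv]

/-- For fixed (l, ψ, ψ'), the counts ⌊l/p⌋, ⌊ψ'/p⌋ and ⌊ψ/p⌋ in `competitivenessAt_le` give a bound
that converges to κ(l, ψ, ψ')/ψ. -/
theorem competitiveness_le_closedForm (τ : TieRule) {f : ℝ → ℝ} (hf : f ∈ F₀) (hf0 : f 0 < 1) :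
    competitiveness τ f ≤ closedForm f := by
  refine le_iInf fun l => le_iInf fun ψ => le_iInf fun ψ' => le_iInf fun hl => le_iInf fun hψ =>
    le_iInf fun hψ' => ?_
  set x : ℝ → ℝ := fun p => (⌊l / p⌋₊ : ℝ) * p
  set y : ℝ → ℝ := fun p => (⌊ψ' / p⌋₊ : ℝ) * p
  set z : ℝ → ℝ := fun p => (⌊ψ / p⌋₊ : ℝ) * p
  have tx : Tendsto x (𝓝[>] 0) (𝓝 l) := tendsto_natFloor_div_mul hl
  have ty : Tendsto y (𝓝[>] 0) (𝓝 ψ') := tendsto_natFloor_div_mul hψ'.1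
  have tz : Tendsto z (𝓝[>] 0) (𝓝 ψ) := tendsto_natFloor_div_mul hψ.1.le
  have tp : Tendsto (fun p : ℝ => p) (𝓝[>] 0) (𝓝 0) := tendsto_id.mono_left nhdsWithin_le_nhds
  have hx0 : ∀ᶠ p in 𝓝[>] (0 : ℝ), 0 ≤ x p := by
    filter_upwards [self_mem_nhdsWithin] with p hp
    exact mul_nonneg (Nat.cast_nonneg _) (le_of_lt hp)
  have hy0 : ∀ᶠ p in 𝓝[>] (0 : ℝ), 0 ≤ y p := by
    filter_upwards [self_mem_nhdsWithin] with p hp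
    exact mul_nonneg (Nat.cast_nonneg _) (le_of_lt hp)
  have tf : Tendsto (fun p => f (x p + y p)) (𝓝[>] 0) (𝓝 (f (l + ψ'))) := by
    refine (hf.1 (l + ψ') (add_nonneg hl hψ'.1)).tendsto.comp
      (tendsto_nhdsWithin_iff.2 ⟨tx.add ty, ?_⟩)
    filter_upwards [hx0, hy0] with p h1 h2
    exact add_nonneg h1 h2
  have tF : Tendsto (fun p => ∫ t in (0 : ℝ)..(x p), Real.exp (-t) * f t) (𝓝[>] 0)
      (𝓝 (∫ t in (0 : ℝ)..l, Real.exp (-t) * f t)) := by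
    have hl1 : (0 : ℝ) ≤ l + 1 := by linarith
    have hcont := intervalIntegral.continuousOn_primitive_interval
      ((intervalIntegrable_iff' enorm_ne_top).1 (F₀.intervalIntegrable hf le_rfl hl1))
    rw [Set.uIcc_of_le hl1] at hcont
    refine (hcont l ⟨hl, by linarith⟩).tendsto.comp (tendsto_nhdsWithin_iff.2 ⟨tx, ?_⟩)
    filter_upwards [hx0, tx.eventually_le_const (lt_add_one l)] with p h1 h2
    exact ⟨h1, h2⟩
  have te : ∀ {g : ℝ → ℝ} {c : ℝ}, Tendsto g (𝓝[>] 0) (𝓝 c) →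
      Tendsto (fun p => Real.exp (g p)) (𝓝[>] 0) (𝓝 (Real.exp c)) :=
    fun h => (Real.continuous_exp.tendsto _).comp h
  have tR := ((((te tp).mul (tF.add ((te tx.neg).sub (te (tx.add ty).neg)))).add
    ((tz.sub ty).mul ((tf.const_sub 1).add tp))).div tz hψ.1.ne')
  have hlim : (Real.exp 0 * ((∫ t in (0 : ℝ)..l, Real.exp (-t) * f t)
      + (Real.exp (-l) - Real.exp (-(l + ψ')))) + (ψ - ψ') * (1 - f (l + ψ') + 0)) / ψ
      = kappa f l ψ ψ' / ψ := by
    rw [kappa, integral_exp_neg, Real.exp_zero]; ring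
  rw [hlim] at tR
  refine le_trans (limsup_le_limsup ?_) ((continuous_coe_real_ereal.tendsto _).comp tR).limsup_eq.le
  filter_upwards [self_mem_nhdsWithin,
    tp.eventually_le_const hψ.1] with p hp hpψ
  have hp0 : 0 < p := hp
  refine competitivenessAt_le τ hf hf0 hp0 (Nat.floor_mono (by gcongr; exact hψ'.2))
    (Nat.floor_pos.2 ((one_le_div hp0).2 hpψ)) ?_
  exact ((le_div_iff₀ hp0).1 (Nat.floor_le (div_pos hψ.1 hp0).le)).trans hψ.2

/-! ### The degenerate case f(0) = 1 and the final bounds -/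

/-- Two offline vertices of weight one that compete for a single online vertex. -/
def competitionInstance : Instance 2 1 where
  w _ := 1
  w_pos _ := one_pos
  nbr _ := Finset.univ

/-- If `f 0 = 1` then all scores vanish at the start, and the vertex that loses the tie receives
nothing. -/
lemma competitivenessAt_le_zero (τ : TieRule) {f : ℝ → ℝ} (hf0 : f 0 = 1) (p : ℝ) :
    competitivenessAt τ f p ≤ 0 := by
  set u₀ : Fin 2 := τ.pick competitionInstance p (fun _ => none) 0 Finset.univ
    Finset.univ_nonempty
  obtain ⟨u, hu⟩ : ∃ u : Fin 2, u ≠ u₀ := exists_ne u₀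
  refine iInf_le_of_le _ <| iInf_le_of_le _ <| iInf_le_of_le competitionInstance <|
    iInf_le_of_le u <| iInf_le_of_le {0} <| iInf_le_of_le (Finset.singleton_nonempty _) <|
    iInf_le_of_le (by simp [Instance.onlineNbr, competitionInstance]) ?_
  have hae : (fun Θ => (run τ competitionInstance p f Θ).α u
        + ∑ v ∈ {0}, (run τ competitionInstance p f Θ).β v)
      =ᵐ[thresholdLaw 2] fun _ => 0 := by
    filter_upwards [ae_thresholdLaw_pos 2] with Θ hΘ
    have hcand : candidates competitionInstance p f Θ (State.init 2 1) 0 = Finset.univ := by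
      ext u
      simp [candidates, available, score, competitionInstance, State.init, hΘ]
    have hpick : ∀ hT, τ.pick competitionInstance p (State.init 2 1).assigned 0
        (candidates competitionInstance p f Θ (State.init 2 1) 0) hT = u₀ := by
      rw [hcand]
      exact fun _ => rfl
    have hrun : run τ competitionInstance p f Θ
        = step τ competitionInstance p f Θ (State.init 2 1) 0 := rfl
    rw [hrun, step, dif_pos (by simp [hcand])]
    simp only [hpick]
    simp [Function.update_of_ne hu, State.init, hf0]
  rw [ratio, expectedDual, integral_congr_ae hae]
  simp

theorem competitiveness_le (τ : TieRule) {f : ℝ → ℝ} (hf : f ∈ F₀) :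
    competitiveness τ f ≤ ((0.581 : ℝ) : EReal) := by
  rcases (hf.2.2 (Set.mem_Ici.2 le_rfl)).2.lt_or_eq with h | h
  · exact (competitiveness_le_closedForm τ hf h).trans (closedForm_le hf)
  · refine (limsup_le_of_le (by isBoundedDefault)
      (Eventually.of_forall (competitivenessAt_le_zero τ h))).trans ?_
    exact_mod_cast (by norm_num : (0 : ℝ) ≤ 0.581)

lemma optValue_le {L : (ℝ → ℝ) → EReal} (hL : ∀ f ∈ F₀, L f ≤ ((0.581 : ℝ) : EReal))
    {F : Set (ℝ → ℝ)} (hF : F ⊆ F₀) {c : ℝ} (hc : 0.581 ≤ c) : optValue L F ≤ (c : EReal) :=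
  iSup₂_le fun f hf => (hL f (hF hf)).trans (EReal.coe_le_coe hc)

end StochasticBalance

theorem mainTheorem3 (τ : StochasticBalance.TieRule) :
    (StochasticBalance.optValue (StochasticBalance.competitiveness τ) StochasticBalance.F₀
        ≤ ((0.5841 : ℝ) : EReal) ∧
      StochasticBalance.optValue (StochasticBalance.competitiveness τ) StochasticBalance.F₁
        ≤ ((0.5810 : ℝ) : EReal)) ∧
    (StochasticBalance.optValue StochasticBalance.closedForm StochasticBalance.F₀
        ≤ ((0.5841 : ℝ) : EReal) ∧
      StochasticBalance.optValue StochasticBalance.closedForm StochasticBalance.F₁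
        ≤ ((0.5810 : ℝ) : EReal)) := by
  have h₀ := fun f => StochasticBalance.competitiveness_le τ (f := f)
  have h₁ := fun f => StochasticBalance.closedForm_le (f := f)
  have hF : StochasticBalance.F₁ ⊆ StochasticBalance.F₀ := Set.inter_subset_left
  exact ⟨⟨StochasticBalance.optValue_le h₀ subset_rfl (by norm_num),
      StochasticBalance.optValue_le h₀ hF (by norm_num)⟩,
    StochasticBalance.optValue_le h₁ subset_rfl (by norm_num),
      StochasticBalance.optValue_le h₁ hF (by norm_num)⟩
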